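/- Let $S$ be an inverse semigroup with idempotent set $E(S)$ and natural order ($s\le t$ iff $s=ts^*s$), let $X$ be a zero-dimensional locally compact Hausdorff space (i.e. a Hausdorff space with a basis of compact-open sets), and let $R$ be a commutative unital ring. Let $\theta$ be a topological partial action of $S$ on $X$: open sets $X_s\subseteq X$ and homeomorphisms $\theta_s:X_{s^*}\to X_s$ ($s\in S$) such that $X=\bigcup_{e\in E(S)}X_e$, $\theta_s(X_{s^*}\cap X_t)=X_s\cap X_{st}$, and $\theta_s(\theta_t(x))=\theta_{st}(x)$ for all $x\in X_{t^*}\cap X_{t^*s^*}$. Assume that $\theta$ is topologically principal: the set $$\Lambda(\theta)=\{x\in X\mid \text{for all } s\in S \text{ with } x\in X_{s^*} \text{ and } \theta_s(x)=x \text{ there is } e\in E(S) \text{ with } e\le s \text{ and } x\in X_e\}$$ is dense in $X$. Let $\mathcal L_c(X)$ be the ring of locally constant, compactly supported functions $X\to R$, with $\operatorname{supp}(f)=\{x\mid f(x)\ne 0\}$, let $D_s=\{f\in\mathcal L_c(X)\mid \operatorname{supp}(f)\subseteq X_s\}$, and let $\alpha_s:D_{s^*}\to D_s$ be given by $\alpha_s(f)=f\circ\theta_{s^*}$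 on $X_s$ and $0$ off $X_s$. Let $\mathcal L$ be the ring of finite formal sums $\sum_s f_s\delta_s$ with $f_s\in D_s$ and multiplication $(f\delta_s)(g\delta_t)=\alpha_s(\alpha_{s^*}(f)g)\delta_{st}$, let $\mathcal N$ be the two-sided ideal of $\mathcal L$ generated by all $f\delta_r-f\delta_s$ with $r\le s$ and $f\in D_r$, and let $\mathcal L_c(X)\rtimes_\alpha S=\mathcal L/\mathcal N$. Let $\widetilde\tau:\mathcal L_c(X)\rtimes_\alpha S\to\mathcal L_c(X)$ be the well-defined additive map $\overline{\sum_s f_s\delta_s}\mapsto\sum_s f_s$, and let the diagonal $\mathcal D$ be the subring of all finite sums $\sum_i\overline{f_i\delta_{e_i}}$ with $e_i\in E(S)$ and $f_i\in D_{e_i}$. (1) If $\mathcal I$ is a non-zero two-sided ideal of $\mathcal L_c(X)\rtimes_\alpha S$ and there is some $\overline f\in\mathcal I$ with $\operatorname{supp}(\widetilde\tau(\overline f))\neq\emptyset$, then $\mathcal I\cap\mathcal D\neq\{0\}$. (2) If every non-zero two-sided ideal $\mathcal I$ of $\mathcal L_c(X)\rtimes_\alpha S$ contains some $\overline f$ with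 $\operatorname{supp}(\widetilde\tau(\overline f))\neq\emptyset$, then $\mathcal D$ is a maximal commutative subring of $\mathcal L_c(X)\rtimes_\alpha S$, i.e. $\mathcal D$ equals its own centralizer. -/

import Mathlib

/-! ### Inverse semigroups -/

/-- An inverse semigroup: a semigroup in which every `s` has exactly one `s⁻¹` (written `s^*` in
the literature) with `s s⁻¹ s = s` and `s⁻¹ s s⁻¹ = s⁻¹`. -/
class InverseSemigroup (S : Type*) extends Semigroup S, Inv S where
  mul_inv_mul_self : ∀ s : S, s * s⁻¹ * s = s
  inv_mul_inv_self : ∀ s : S, s⁻¹ * s * s⁻¹ = s⁻¹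
  eq_inv_of : ∀ s t : S, s * t * s = s → t * s * t = t → t = s⁻¹

namespace InverseSemigroup

variable {S : Type*} [InverseSemigroup S]

/-- The natural partial order of an inverse semigroup: `s ≤ t` iff `s = t s⁻¹ s`. -/
def NatLE (s t : S) : Prop := s = t * (s⁻¹ * s)

theorem inv_inv_eq (s : S) : s⁻¹⁻¹ = s :=
  (eq_inv_of s⁻¹ s (inv_mul_inv_self s) (mul_inv_mul_self s)).symm

theorem inv_eq_self {e : S} (he : IsIdempotentElem e) : e⁻¹ = e :=
  (eq_inv_of e e (by rw [he.eq, he.eq]) (by rw [he.eq, he.eq])).symm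

theorem isIdempotentElem_mul {e f : S} (he : IsIdempotentElem e) (hf : IsIdempotentElem f) :
    IsIdempotentElem (e * f) := by
  have h1 := mul_inv_mul_self (e * f)
  have h2 := inv_mul_inv_self (e * f)
  set x := (e * f)⁻¹ with hx
  have he' : ∀ y, e * (e * y) = e * y := fun y => by rw [← mul_assoc, he.eq]
  have hf' : ∀ y, f * (f * y) = f * y := fun y => by rw [← mul_assoc, hf.eq]
  simp only [mul_assoc] at h1 h2
  have h2' : ∀ y, x * (e * (f * (x * y))) = x * y := fun y => by
    have := congrArg (· * y) h2
    simpa only [mul_assoc] using this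
  have hfx : f * (x * e) = x := by
    refine eq_inv_of (e * f) _ ?_ ?_
    · simp only [mul_assoc, he', hf', h1]
    · simp only [mul_assoc, he', hf', h2']
  have hxx : IsIdempotentElem x := by
    have : (f * (x * e)) * (f * (x * e)) = f * (x * e) := by
      simp only [mul_assoc, h2']
    rwa [hfx] at this
  have h3 : e * f = x := by
    rw [← inv_inv_eq (e * f), ← hx, inv_eq_self hxx]
  rw [h3]; exact hxx

theorem idem_comm {e f : S} (he : IsIdempotentElem e) (hf : IsIdempotentElem f) :
    e * f = f * e := by
  have h1 := isIdempotentElem_mul he hf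
  have h2 := isIdempotentElem_mul hf he
  have he' : ∀ y, e * (e * y) = e * y := fun y => by rw [← mul_assoc, he.eq]
  have hf' : ∀ y, f * (f * y) = f * y := fun y => by rw [← mul_assoc, hf.eq]
  have h1e := h1.eq
  have h2e := h2.eq
  simp only [mul_assoc] at h1e h2e
  have h3 : f * e = (e * f)⁻¹ := by
    refine eq_inv_of _ _ ?_ ?_
    · simp only [mul_assoc, he', hf', h1e]
    · simp only [mul_assoc, he', hf', h2e]
  rw [h3, inv_eq_self h1]

theorem isIdempotentElem_mul_inv (s : S) : IsIdempotentElem (s * s⁻¹) := by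
  rw [IsIdempotentElem, ← mul_assoc, mul_inv_mul_self]

theorem isIdempotentElem_inv_mul (s : S) : IsIdempotentElem (s⁻¹ * s) := by
  rw [IsIdempotentElem, ← mul_assoc, inv_mul_inv_self]

theorem mul_inv_rev_eq (s t : S) : (s * t)⁻¹ = t⁻¹ * s⁻¹ := by
  have hc := idem_comm (isIdempotentElem_mul_inv t) (isIdempotentElem_inv_mul s)
  symm
  refine eq_inv_of _ _ ?_ ?_
  · calc s * t * (t⁻¹ * s⁻¹) * (s * t) = s * (t * t⁻¹ * (s⁻¹ * s)) * t := by simp only [mul_assoc]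
      _ = s * s⁻¹ * s * (t * t⁻¹ * t) := by rw [hc]; simp only [mul_assoc]
      _ = s * t := by rw [mul_inv_mul_self, mul_inv_mul_self]
  · calc t⁻¹ * s⁻¹ * (s * t) * (t⁻¹ * s⁻¹) = t⁻¹ * (s⁻¹ * s * (t * t⁻¹)) * s⁻¹ := by
          simp only [mul_assoc]
      _ = t⁻¹ * t * t⁻¹ * (s⁻¹ * s * s⁻¹) := by rw [← hc]; simp only [mul_assoc]
      _ = t⁻¹ * s⁻¹ := by rw [inv_mul_inv_self, inv_mul_inv_self]

theorem natLE_of_eq_mul_idem {r s e : S} (he : IsIdempotentElem e) (h : r = s * e) :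
    NatLE r s := by
  have hc := idem_comm (isIdempotentElem_inv_mul s) he
  subst h
  rw [NatLE, mul_inv_rev_eq, inv_eq_self he]
  calc s * e = s * s⁻¹ * s * (e * e) := by rw [mul_inv_mul_self, he.eq]
    _ = s * (s⁻¹ * s * e * e) := by simp only [mul_assoc]
    _ = s * (e * s⁻¹ * (s * e)) := by rw [hc]; simp only [mul_assoc]

theorem isIdempotentElem_conj {f : S} (s : S) (hf : IsIdempotentElem f) :
    IsIdempotentElem (s⁻¹ * f * s) := by
  have hc := idem_comm hf (isIdempotentElem_mul_inv s)
  calc s⁻¹ * f * s * (s⁻¹ * f * s) = s⁻¹ * (f * (s * s⁻¹)) * f * s := by simp only [mul_assoc]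
    _ = s⁻¹ * s * s⁻¹ * (f * f) * s := by rw [hc]; simp only [mul_assoc]
    _ = s⁻¹ * f * s := by rw [inv_mul_inv_self, hf.eq]

theorem natLE_of_eq_idem_mul {r s f : S} (hf : IsIdempotentElem f) (h : r = f * s) :
    NatLE r s := by
  refine natLE_of_eq_mul_idem (isIdempotentElem_conj s hf) ?_
  have hc := idem_comm hf (isIdempotentElem_mul_inv s)
  calc r = f * (s * s⁻¹ * s) := by rw [mul_inv_mul_self, h]
    _ = f * (s * s⁻¹) * s := by simp only [mul_assoc]
    _ = s * (s⁻¹ * f * s) := by rw [hc]; simp only [mul_assoc]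

theorem NatLE.exists_idem_mul {r s : S} (h : NatLE r s) :
    ∃ f : S, IsIdempotentElem f ∧ r = f * s := by
  have he := isIdempotentElem_inv_mul r
  have hc := idem_comm he (isIdempotentElem_inv_mul s)
  refine ⟨s * (r⁻¹ * r) * s⁻¹, ?_, ?_⟩
  · have := isIdempotentElem_conj s⁻¹ he
    rwa [inv_inv_eq] at this
  · calc r = s * (r⁻¹ * r) := h
      _ = s * s⁻¹ * s * (r⁻¹ * r) := by rw [mul_inv_mul_self]
      _ = s * (s⁻¹ * s * (r⁻¹ * r)) := by simp only [mul_assoc]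
      _ = s * (r⁻¹ * r) * s⁻¹ * s := by rw [← hc]; simp only [mul_assoc]

theorem NatLE.mul_left {r s : S} (h : NatLE r s) (t : S) : NatLE (t * r) (t * s) :=
  natLE_of_eq_mul_idem (isIdempotentElem_inv_mul r) (by rw [mul_assoc, ← h])

theorem NatLE.mul_right {r s : S} (h : NatLE r s) (u : S) : NatLE (r * u) (s * u) := by
  obtain ⟨f, hf, h⟩ := h.exists_idem_mul
  exact natLE_of_eq_idem_mul hf (by rw [h, mul_assoc])

theorem NatLE.inv {r s : S} (h : NatLE r s) : NatLE r⁻¹ s⁻¹ := by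
  obtain ⟨f, hf, h⟩ := h.exists_idem_mul
  exact natLE_of_eq_mul_idem hf (by rw [h, mul_inv_rev_eq, inv_eq_self hf])

end InverseSemigroup

open InverseSemigroup

/-! ### Partial actions of inverse semigroups on rings -/

/-- A partial action of an inverse semigroup `S` on a (not necessarily unital) ring `A`: two-sided
ideals `D s` and ring isomorphisms `π s : D s⁻¹ → D s` such that
(i) `A` is additively generated by the `D e`, `e` idempotent;
(ii) `π s (D s⁻¹ ∩ D t) = D s ∩ D (s t)`;
(iii) `π s (π t x) = π (s t) x` for all `x ∈ D t⁻¹ ∩ D (s t)⁻¹`, the left side being meaningful. -/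
structure RingPartialAction (S A : Type*) [InverseSemigroup S] [NonUnitalRing A] where
  D : S → TwoSidedIdeal A
  π : ∀ s : S, D s⁻¹ ≃+* D s
  generates : AddSubgroup.closure {a : A | ∃ e : S, IsIdempotentElem e ∧ a ∈ D e} = ⊤
  image_inter : ∀ s t : S,
    (fun x : D s⁻¹ => (π s x : A)) '' {x | (x : A) ∈ D t} = {a : A | a ∈ D s ∧ a ∈ D (s * t)}
  comp : ∀ (s t : S) (x : A) (hx : x ∈ D t⁻¹) (hx' : x ∈ D (s * t)⁻¹),
    ∃ hy : (π t ⟨x, hx⟩ : A) ∈ D s⁻¹, (π s ⟨π t ⟨x, hx⟩, hy⟩ : A) = π (s * t) ⟨x, hx'⟩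

namespace RingPartialAction

variable {S A : Type*} [InverseSemigroup S] [NonUnitalRing A] (P : RingPartialAction S A)

theorem π_congr {s t : S} (h : s = t) {a b : A} (hab : a = b) (ha : a ∈ P.D s⁻¹)
    (hb : b ∈ P.D t⁻¹) : (P.π s ⟨a, ha⟩ : A) = P.π t ⟨b, hb⟩ := by
  subst h; subst hab; rfl

theorem mem_inv_inv {s : S} {a : A} (ha : a ∈ P.D s) : a ∈ P.D s⁻¹⁻¹ := by
  rwa [inv_inv_eq]

theorem mem_mul_inv {s : S} {a : A} (ha : a ∈ P.D s) : a ∈ P.D (s * s⁻¹) := by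
  have h : a ∈ (fun x : P.D s⁻¹ => (P.π s x : A)) '' {x | (x : A) ∈ P.D s⁻¹} :=
    ⟨(P.π s).symm ⟨a, ha⟩, ((P.π s).symm ⟨a, ha⟩).2, by simp⟩
  rw [P.image_inter] at h
  exact h.2

theorem π_idem {e : S} (he : IsIdempotentElem e) {a : A} (ha : a ∈ P.D e⁻¹) :
    (P.π e ⟨a, ha⟩ : A) = a := by
  have ha' : a ∈ P.D (e * e)⁻¹ := by rwa [he.eq]
  obtain ⟨hy, h⟩ := P.comp e e a ha ha'
  rw [P.π_congr he.eq rfl ha' ha] at h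
  have := (P.π e).injective (Subtype.ext h)
  exact congrArg Subtype.val this

theorem mem_inv_of_natLE_aux {r s : S} (h : NatLE r s) {a : A} (ha : a ∈ P.D r⁻¹) :
    ∃ hs : a ∈ P.D s⁻¹, (P.π s ⟨a, hs⟩ : A) = P.π r ⟨a, ha⟩ := by
  have he := isIdempotentElem_inv_mul r
  have h1 : a ∈ P.D (r⁻¹ * r)⁻¹ := by
    have := P.mem_mul_inv ha
    rwa [inv_inv_eq, ← inv_eq_self he] at this
  have h2 : a ∈ P.D (s * (r⁻¹ * r))⁻¹ := by
    rw [← show r = s * (r⁻¹ * r) from h]; exact ha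
  obtain ⟨hy, hc⟩ := P.comp s (r⁻¹ * r) a h1 h2
  have hid := P.π_idem he h1
  have hs : a ∈ P.D s⁻¹ := by rwa [hid] at hy
  refine ⟨hs, ?_⟩
  rw [P.π_congr rfl hid.symm hs hy, hc]
  exact P.π_congr (show r = s * (r⁻¹ * r) from h).symm rfl _ _

theorem D_mono {r s : S} (h : NatLE r s) {a : A} (ha : a ∈ P.D r) : a ∈ P.D s := by
  obtain ⟨hs, -⟩ := P.mem_inv_of_natLE_aux h.inv (P.mem_inv_inv ha)
  rwa [inv_inv_eq] at hs

theorem π_restrict {r s : S} (h : NatLE r s) {a : A} (ha : a ∈ P.D r⁻¹) (hs : a ∈ P.D s⁻¹) :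
    (P.π s ⟨a, hs⟩ : A) = P.π r ⟨a, ha⟩ :=
  (P.mem_inv_of_natLE_aux h ha).2

/-- The coefficient `π_s (π_{s⁻¹}(a) b) ∈ D (s t)` of the product `(a δ_s)(b δ_t)`. -/
def prod (s t : S) (a : P.D s) (b : P.D t) : P.D (s * t) :=
  ⟨P.π s ⟨(P.π s⁻¹ ⟨a, P.mem_inv_inv a.2⟩ : A) * b,
      (P.D s⁻¹).mul_mem_right _ _ (P.π s⁻¹ ⟨a, P.mem_inv_inv a.2⟩).2⟩, by
    have h := (P.image_inter s t).subset
      ⟨⟨(P.π s⁻¹ ⟨a, P.mem_inv_inv a.2⟩ : A) * b,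
        (P.D s⁻¹).mul_mem_right _ _ (P.π s⁻¹ ⟨a, P.mem_inv_inv a.2⟩).2⟩,
        (P.D t).mul_mem_left _ _ b.2, rfl⟩
    exact h.2⟩

theorem coe_prod (s t : S) (a : P.D s) (b : P.D t) :
    (P.prod s t a b : A) = P.π s ⟨(P.π s⁻¹ ⟨a, P.mem_inv_inv a.2⟩ : A) * b,
      (P.D s⁻¹).mul_mem_right _ _ (P.π s⁻¹ ⟨a, P.mem_inv_inv a.2⟩).2⟩ := rfl

theorem prod_add_left (s t : S) (a a' : P.D s) (b : P.D t) :
    P.prod s t (a + a') b = P.prod s t a b + P.prod s t a' b := by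
  apply Subtype.ext
  change _ = (P.prod s t a b : A) + (P.prod s t a' b : A)
  simp only [coe_prod]
  change _ = ((P.π s _ + P.π s _ : P.D s) : A)
  rw [← map_add]
  congr 2
  apply Subtype.ext
  change _ = (P.π s⁻¹ _ : A) * b + (P.π s⁻¹ _ : A) * b
  rw [← add_mul]
  exact congrArg (fun z : P.D s⁻¹ => (z : A) * b) (map_add (P.π s⁻¹)
    ⟨a, P.mem_inv_inv a.2⟩ ⟨a', P.mem_inv_inv a'.2⟩)

theorem prod_add_right (s t : S) (a : P.D s) (b b' : P.D t) :
    P.prod s t a (b + b') = P.prod s t a b + P.prod s t a b' := by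
  apply Subtype.ext
  change _ = (P.prod s t a b : A) + (P.prod s t a b' : A)
  simp only [coe_prod]
  change _ = ((P.π s _ + P.π s _ : P.D s) : A)
  rw [← map_add]
  congr 2
  apply Subtype.ext
  change _ = (P.π s⁻¹ _ : A) * b + (P.π s⁻¹ _ : A) * b'
  rw [← mul_add]
  rfl

/-! ### The skew inverse semigroup ring -/

/-- The ring `𝓛` of finite formal sums `∑ a_s δ_s` with `a_s ∈ D s`. -/
def PreSkewRing : Type _ := DirectSum S fun s => P.D s

noncomputable section

instance : AddCommGroup P.PreSkewRing :=
  inferInstanceAs (AddCommGroup (DirectSum S fun s => P.D s))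

open scoped Classical in
/-- The homogeneous element `a δ_s`. -/
def single (s : S) : P.D s →+ P.PreSkewRing := DirectSum.of (fun s => P.D s) s

/-- The additive map out of `𝓛` determined by its values on homogeneous elements. -/
def lift {M : Type*} [AddCommMonoid M] (φ : ∀ s, P.D s →+ M) : P.PreSkewRing →+ M :=
  open scoped Classical in DirectSum.toAddMonoid φ

theorem lift_single {M : Type*} [AddCommMonoid M] (φ : ∀ s, P.D s →+ M) (s : S) (a : P.D s) :
    P.lift φ (P.single s a) = φ s a := by
  classical
  exact DirectSum.toAddMonoid_of φ s a

theorem preSkewRing_induction {p : P.PreSkewRing → Prop} (x : P.PreSkewRing) (zero : p 0)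
    (single : ∀ s a, p (P.single s a)) (add : ∀ x y, p x → p y → p (x + y)) : p x := by
  classical
  exact DirectSum.induction_on x zero single add

/-- The biadditive extension of `(a δ_s)(b δ_t) = π_s (π_{s⁻¹}(a) b) δ_{s t}`. -/
def mulHom : P.PreSkewRing →+ P.PreSkewRing →+ P.PreSkewRing :=
  P.lift fun s => AddMonoidHom.flip <| P.lift fun t => AddMonoidHom.flip <|
    AddMonoidHom.mk' (fun a => AddMonoidHom.mk' (fun b => P.single (s * t) (P.prod s t a b))
      fun b b' => by rw [prod_add_right, map_add])
      fun a a' => by ext b; simp [prod_add_left]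

instance : NonUnitalNonAssocRing P.PreSkewRing where
  __ := (inferInstance : AddCommGroup P.PreSkewRing)
  mul x y := P.mulHom x y
  left_distrib x y z := map_add (P.mulHom x) y z
  right_distrib x y z := by
    change P.mulHom (x + y) z = P.mulHom x z + P.mulHom y z
    rw [map_add]; rfl
  zero_mul x := by
    change P.mulHom 0 x = 0
    rw [map_zero]; rfl
  mul_zero x := map_zero (P.mulHom x)

theorem single_mul_single (s t : S) (a : P.D s) (b : P.D t) :
    P.single s a * P.single t b = P.single (s * t) (P.prod s t a b) := by
  change P.mulHom _ _ = _
  simp [mulHom, lift_single]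

/-- The elements `a δ_r - a δ_s` with `r ≤ s` and `a ∈ D r`. -/
def relators : Set P.PreSkewRing :=
  {x | ∃ (r s : S) (h : NatLE r s) (a : P.D r),
    x = P.single r a - P.single s ⟨a, P.D_mono h a.2⟩}

/-- The ideal `𝓝` of `𝓛` generated by the elements `a δ_r - a δ_s` with `r ≤ s` and `a ∈ D r`. -/
def relIdeal : TwoSidedIdeal P.PreSkewRing := TwoSidedIdeal.span P.relators

/-- The skew inverse semigroup ring `A ⋊ S = 𝓛 / 𝓝`. -/
abbrev SkewRing : Type _ := P.relIdeal.ringCon.Quotient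

/-- The class of `x ∈ 𝓛` in `A ⋊ S`. -/
abbrev toSkew (x : P.PreSkewRing) : P.SkewRing := RingCon.toQuotient x

/-- The additive map `τ : 𝓛 → A`, `∑ a_s δ_s ↦ ∑ a_s`. -/
def tau : P.PreSkewRing →+ A := P.lift fun s => (P.D s).coeAddMonoidHom

theorem tau_single (s : S) (a : P.D s) : P.tau (P.single s a) = a := P.lift_single _ s a

theorem single_congr {s t : S} (h : s = t) {a : P.D s} {b : P.D t} (hab : (a : A) = b) :
    P.single s a = P.single t b := by
  subst h
  rw [Subtype.ext hab]

theorem mem_closure_of_mem_relIdeal {x : P.PreSkewRing} (hx : x ∈ P.relIdeal) :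
    x ∈ AddSubgroup.closure P.relators := by
  induction hx using TwoSidedIdeal.span_induction with
  | mem x h => exact AddSubgroup.subset_closure h
  | zero => exact zero_mem _
  | add x y _ _ hx hy => exact add_mem hx hy
  | neg x _ hx => exact neg_mem hx
  | left_absorb b x hx0 hx =>
    clear hx0
    induction hx using AddSubgroup.closure_induction with
    | mem x h =>
      obtain ⟨r, s, h, a, rfl⟩ := h
      induction b using P.preSkewRing_induction with
      | zero => rw [zero_mul]; exact zero_mem _
      | add x y hx hy => rw [add_mul]; exact add_mem hx hy
      | single t b =>
        rw [mul_sub, single_mul_single, single_mul_single]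
        exact AddSubgroup.subset_closure ⟨t * r, t * s, h.mul_left t, P.prod t r b a, rfl⟩
    | zero => rw [mul_zero]; exact zero_mem _
    | add x y _ _ hx hy => rw [mul_add]; exact add_mem hx hy
    | neg x _ hx => rw [mul_neg]; exact neg_mem hx
  | right_absorb b x hx0 hx =>
    clear hx0
    induction hx using AddSubgroup.closure_induction with
    | mem x h =>
      obtain ⟨r, s, h, a, rfl⟩ := h
      induction b using P.preSkewRing_induction with
      | zero => rw [mul_zero]; exact zero_mem _
      | add x y hx hy => rw [mul_add]; exact add_mem hx hy
      | single u c =>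
        rw [sub_mul, single_mul_single, single_mul_single]
        refine AddSubgroup.subset_closure ⟨r * u, s * u, h.mul_right u, P.prod r u a c, ?_⟩
        congr 2
        apply Subtype.ext
        simp only [coe_prod]
        have h1 := P.π_restrict h.inv (P.mem_inv_inv a.2) (P.mem_inv_inv (P.D_mono h a.2))
        have hm : (P.π r⁻¹ ⟨a, P.mem_inv_inv a.2⟩ : A) * c ∈ P.D r⁻¹ :=
          (P.D r⁻¹).mul_mem_right _ _ (P.π r⁻¹ ⟨a, P.mem_inv_inv a.2⟩).2
        rw [← P.π_restrict h hm (P.D_mono h.inv hm)]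
        exact P.π_congr rfl (by rw [h1]) _ _
    | zero => rw [zero_mul]; exact zero_mem _
    | add x y _ _ hx hy => rw [add_mul]; exact add_mem hx hy
    | neg x _ hx => rw [neg_mul]; exact neg_mem hx

theorem tau_eq_zero_of_mem_relIdeal {x : P.PreSkewRing} (hx : x ∈ P.relIdeal) :
    P.tau x = 0 := by
  have h := P.mem_closure_of_mem_relIdeal hx
  clear hx
  induction h using AddSubgroup.closure_induction with
  | mem x h =>
    obtain ⟨r, s, h, a, rfl⟩ := h
    rw [map_sub, tau_single, tau_single, sub_self]
  | zero => exact map_zero _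
  | add x y _ _ hx hy => rw [map_add, hx, hy, add_zero]
  | neg x _ hx => rw [map_neg, hx, neg_zero]

/-- The additive map `τ̃ : A ⋊ S → A` induced by `τ`. -/
def tauTilde : P.SkewRing →+ A where
  toFun := Quotient.lift (fun x => P.tau x) fun x y h => by
    rw [← sub_eq_zero, ← map_sub]
    exact P.tau_eq_zero_of_mem_relIdeal ((P.relIdeal.rel_iff x y).1 h)
  map_zero' := map_zero P.tau
  map_add' x y := by
    induction x using Quotient.inductionOn
    induction y using Quotient.inductionOn
    exact map_add P.tau _ _

theorem tauTilde_toSkew (x : P.PreSkewRing) : P.tauTilde (P.toSkew x) = P.tau x := rfl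

/-- The diagonal of `A ⋊ S`: the subring of all finite sums `∑ a_i δ_{e_i}` with `e_i` idempotent
and `a_i ∈ D e_i`. -/
def diagonal : NonUnitalSubring P.SkewRing where
  carrier := {x | ∃ (n : ℕ) (e : Fin n → S) (a : ∀ i, P.D (e i)),
    (∀ i, IsIdempotentElem (e i)) ∧ x = ∑ i, P.toSkew (P.single (e i) (a i))}
  zero_mem' := ⟨0, Fin.elim0, fun i => i.elim0, fun i => i.elim0, by simp⟩
  add_mem' := by
    rintro _ _ ⟨n, e, a, he, rfl⟩ ⟨m, f, b, hf, rfl⟩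
    refine ⟨n + m, Fin.append e f,
      Fin.addCases (fun i => ⟨a i, by rw [Fin.append_left]; exact (a i).2⟩)
        (fun i => ⟨b i, by rw [Fin.append_right]; exact (b i).2⟩), ?_, ?_⟩
    · intro i
      refine Fin.addCases (fun i => ?_) (fun i => ?_) i
      · rw [Fin.append_left]; exact he i
      · rw [Fin.append_right]; exact hf i
    · rw [Fin.sum_univ_add]
      congr 1
      · refine Finset.sum_congr rfl fun i _ => congrArg _ (P.single_congr (by simp) ?_)
        simp
      · refine Finset.sum_congr rfl fun i _ => congrArg _ (P.single_congr (by simp) ?_)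
        simp
  neg_mem' := by
    rintro _ ⟨n, e, a, he, rfl⟩
    refine ⟨n, e, fun i => -a i, he, ?_⟩
    rw [← Finset.sum_neg_distrib]
    refine Finset.sum_congr rfl fun i _ => ?_
    rw [map_neg]; rfl
  mul_mem' := by
    rintro _ _ ⟨n, e, a, he, rfl⟩ ⟨m, f, b, hf, rfl⟩
    let k := finProdFinEquiv (m := n) (n := m)
    refine ⟨n * m, fun i => e (k.symm i).1 * f (k.symm i).2,
      fun i => P.prod _ _ (a (k.symm i).1) (b (k.symm i).2),
      fun i => isIdempotentElem_mul (he _) (hf _), ?_⟩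
    rw [Finset.sum_mul_sum, ← Fintype.sum_prod_type', ← k.symm.sum_comp]
    refine Finset.sum_congr rfl fun i _ => ?_
    rw [← single_mul_single]
    rfl

end

end RingPartialAction

/-- A subset `M` of a ring is maximal commutative if it equals its centralizer. -/
def IsMaximalCommutative {B : Type*} [Mul B] (M : Set B) : Prop := Set.centralizer M = M

/-! ### Topological partial actions -/

/-- A topological partial action of an inverse semigroup `S` on a space `X`: open sets `dom s`
(written `X_s`) and homeomorphisms `θ s : X_{s⁻¹} → X_s` such that
(i) `X` is the union of the `X_e`, `e` idempotent; (ii) `θ s (X_{s⁻¹} ∩ X_t) = X_s ∩ X_{s t}`;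
(iii) `θ s (θ t x) = θ (s t) x` for all `x ∈ X_{t⁻¹} ∩ X_{t⁻¹ s⁻¹}`.
The values of `θ s` outside its source `X_{s⁻¹}` are irrelevant. -/
structure TopologicalPartialAction (S X : Type*) [InverseSemigroup S] [TopologicalSpace X] where
  dom : S → Set X
  θ : S → OpenPartialHomeomorph X X
  source_eq : ∀ s, (θ s).source = dom s⁻¹
  target_eq : ∀ s, (θ s).target = dom s
  cover : ∀ x : X, ∃ e : S, IsIdempotentElem e ∧ x ∈ dom e
  image_inter : ∀ s t : S, θ s '' (dom s⁻¹ ∩ dom t) = dom s ∩ dom (s * t)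
  comp : ∀ (s t : S), ∀ x ∈ dom t⁻¹ ∩ dom (t⁻¹ * s⁻¹), θ s (θ t x) = θ (s * t) x

/-- The ring `𝓛_c(X)` of locally constant, compactly supported, `R`-valued functions on `X`. -/
def LocConstCompact (X R : Type*) [TopologicalSpace X] [CommRing R] :
    NonUnitalSubalgebra R (LocallyConstant X R) where
  carrier := {f | IsCompact (Function.support f)}
  zero_mem' := by simp
  add_mem' {f g} hf hg := (hf.union hg).of_isClosed_subset
    ((f + g).isLocallyConstant.isClopen_fiber 0).compl.isClosed
    (Function.support_add f g)
  mul_mem' {f g} hf _ := hf.of_isClosed_subset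
    ((f * g).isLocallyConstant.isClopen_fiber 0).compl.isClosed
    (Function.support_mul_subset_left f g)
  smul_mem' c f hf := hf.of_isClosed_subset
    ((c • f).isLocallyConstant.isClopen_fiber 0).compl.isClosed
    (Function.support_const_smul_subset c f)

namespace TopologicalPartialAction

variable {S X : Type*} [InverseSemigroup S] [TopologicalSpace X]
  (T : TopologicalPartialAction S X)

/-- The set `Λ(θ)` of all `x` such that for every `s` with `x ∈ X_{s⁻¹}` and `θ_s(x) = x` there is
an idempotent `e ≤ s` with `x ∈ X_e`. -/
def trivialIsotropy : Set X :=
  {x | ∀ s : S, x ∈ T.dom s⁻¹ → T.θ s x = x →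
    ∃ e : S, IsIdempotentElem e ∧ NatLE e s ∧ x ∈ T.dom e}

/-- The partial action is topologically principal if `Λ(θ)` is dense. -/
def TopologicallyPrincipal : Prop := Dense T.trivialIsotropy

theorem mem_mul_inv {s : S} {x : X} (hx : x ∈ T.dom s) : x ∈ T.dom (s * s⁻¹) := by
  have h := T.image_inter s s⁻¹
  rw [Set.inter_self, ← T.source_eq, (T.θ s).image_source_eq_target, T.target_eq] at h
  rw [h] at hx
  exact hx.2

theorem θ_mem {s : S} {x : X} (hx : x ∈ T.dom s⁻¹) : T.θ s x ∈ T.dom s := by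
  rw [← T.target_eq]
  exact (T.θ s).map_source (by rwa [T.source_eq])

theorem θ_inv_mem {s : S} {x : X} (hx : x ∈ T.dom s) : T.θ s⁻¹ x ∈ T.dom s⁻¹ :=
  T.θ_mem (by rwa [inv_inv_eq])

theorem θ_idem {e : S} (he : IsIdempotentElem e) {x : X} (hx : x ∈ T.dom e) : T.θ e x = x := by
  have hi := inv_eq_self he
  have h := T.comp e e x (by rw [hi, he.eq]; exact ⟨hx, hx⟩)
  rw [he.eq] at h
  have hx' : x ∈ T.dom e⁻¹ := by rwa [hi]
  refine (T.θ e).injOn ?_ (by rwa [T.source_eq]) h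
  rw [T.source_eq, hi]
  exact T.θ_mem hx'

theorem θ_θ_inv {s : S} {x : X} (hx : x ∈ T.dom s) : T.θ s (T.θ s⁻¹ x) = x := by
  rw [T.comp s s⁻¹ x, T.θ_idem (isIdempotentElem_mul_inv s) (T.mem_mul_inv hx)]
  rw [inv_inv_eq]
  exact ⟨hx, T.mem_mul_inv hx⟩

theorem θ_inv_θ {s : S} {x : X} (hx : x ∈ T.dom s⁻¹) : T.θ s⁻¹ (T.θ s x) = x := by
  have h := T.θ_θ_inv hx
  rwa [inv_inv_eq] at h

theorem isOpen_dom (s : S) : IsOpen (T.dom s) := by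
  rw [← T.target_eq]
  exact (T.θ s).open_target

theorem continuousOn_θ_inv (s : S) : ContinuousOn (T.θ s⁻¹) (T.dom s) := by
  have h := (T.θ s⁻¹).continuousOn
  rwa [T.source_eq, inv_inv_eq] at h

theorem θ_mem_inv {s t : S} {x : X} (hx : x ∈ T.dom t⁻¹) (hx' : x ∈ T.dom (s * t)⁻¹) :
    T.θ t x ∈ T.dom s⁻¹ := by
  rw [mul_inv_rev_eq] at hx'
  have h1 : T.θ t x ∈ T.θ t '' (T.dom t⁻¹ ∩ T.dom (t⁻¹ * s⁻¹)) := ⟨x, ⟨hx, hx'⟩, rfl⟩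
  rw [T.image_inter] at h1
  have he := isIdempotentElem_mul_inv t
  have h2 : T.θ t x ∈ T.θ (t * t⁻¹) '' (T.dom (t * t⁻¹)⁻¹ ∩ T.dom s⁻¹) := by
    rw [T.image_inter, mul_assoc]
    exact ⟨T.mem_mul_inv h1.1, h1.2⟩
  obtain ⟨z, hz, hzx⟩ := h2
  rw [inv_eq_self he] at hz
  rw [T.θ_idem he hz.1] at hzx
  exact hzx ▸ hz.2

variable (R : Type*) [CommRing R]

/-- The ideal `D_s` of all `f ∈ 𝓛_c(X)` whose support `{x | f x ≠ 0}` is contained in `X_s`. -/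
def suppIdeal (s : S) : TwoSidedIdeal (LocConstCompact X R) :=
  TwoSidedIdeal.mk' {f | Function.support f.1 ⊆ T.dom s}
    (by simp)
    (fun {f g} hf hg => (Function.support_add f.1 g.1).trans (Set.union_subset hf hg))
    (fun {f} hf => (Function.support_neg f.1).subset.trans hf)
    (fun {f g} hg => (Function.support_mul_subset_right f.1 g.1).trans hg)
    (fun {f g} hf => (Function.support_mul_subset_left f.1 g.1).trans hf)

variable {R}

theorem mem_suppIdeal {s : S} {f : LocConstCompact X R} :
    f ∈ T.suppIdeal R s ↔ Function.support f.1 ⊆ T.dom s :=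
  TwoSidedIdeal.mem_mk' _ _ _ _ _ _ _

theorem apply_eq_zero {s : S} {f : LocConstCompact X R} (hf : f ∈ T.suppIdeal R s) {x : X}
    (hx : x ∉ T.dom s) : f.1 x = 0 := by
  by_contra h
  exact hx (T.mem_suppIdeal.1 hf h)

noncomputable section

open scoped Classical in
/-- The function `α_s(f)`: `f (θ_{s⁻¹} x)` for `x ∈ X_s`, and `0` elsewhere. -/
def actFun (s : S) (f : X → R) (x : X) : R := if x ∈ T.dom s then f (T.θ s⁻¹ x) else 0

theorem actFun_of_mem {s : S} (f : X → R) {x : X} (hx : x ∈ T.dom s) :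
    T.actFun s f x = f (T.θ s⁻¹ x) := if_pos hx

theorem actFun_of_notMem {s : S} (f : X → R) {x : X} (hx : x ∉ T.dom s) :
    T.actFun s f x = 0 := if_neg hx

theorem support_actFun {s : S} {f : LocConstCompact X R} (hf : f ∈ T.suppIdeal R s⁻¹) :
    Function.support (T.actFun s f.1) = T.θ s '' Function.support f.1 := by
  have hf' := T.mem_suppIdeal.1 hf
  ext x
  constructor
  · intro h
    by_cases hx : x ∈ T.dom s
    · rw [Function.mem_support, T.actFun_of_mem _ hx] at h
      exact ⟨_, h, T.θ_θ_inv hx⟩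
    · exact absurd (T.actFun_of_notMem _ hx) h
  · rintro ⟨y, hy, rfl⟩
    have hy' := hf' hy
    rw [Function.mem_support, T.actFun_of_mem _ (T.θ_mem hy'), T.θ_inv_θ hy']
    exact hy

theorem isCompact_support_actFun {s : S} {f : LocConstCompact X R}
    (hf : f ∈ T.suppIdeal R s⁻¹) : IsCompact (Function.support (T.actFun s f.1)) := by
  rw [T.support_actFun hf]
  refine IsCompact.image_of_continuousOn f.2 ((T.θ s).continuousOn.mono ?_)
  rw [T.source_eq]
  exact T.mem_suppIdeal.1 hf

theorem actFun_comp {s t : S} {f : LocConstCompact X R} (hf : f ∈ T.suppIdeal R t⁻¹)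
    (hf' : f ∈ T.suppIdeal R (s * t)⁻¹) (x : X) :
    T.actFun s (T.actFun t f.1) x = T.actFun (s * t) f.1 x := by
  by_cases hx : x ∈ T.dom s ∧ T.θ s⁻¹ x ∈ T.dom t
  · have h1 : x ∈ T.θ s '' (T.dom s⁻¹ ∩ T.dom t) :=
      ⟨_, ⟨T.θ_inv_mem hx.1, hx.2⟩, T.θ_θ_inv hx.1⟩
    rw [T.image_inter] at h1
    rw [T.actFun_of_mem _ hx.1, T.actFun_of_mem _ hx.2, T.actFun_of_mem _ h1.2, mul_inv_rev_eq,
      T.comp t⁻¹ s⁻¹ x (by rw [inv_inv_eq, inv_inv_eq]; exact h1)]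
  · have h0 : T.actFun s (T.actFun t f.1) x = 0 := by
      by_cases h : x ∈ T.dom s
      · rw [T.actFun_of_mem _ h, T.actFun_of_notMem _ fun h' => hx ⟨h, h'⟩]
      · rw [T.actFun_of_notMem _ h]
    rw [h0]
    by_contra hne
    have hxst : x ∈ T.dom (s * t) := by
      by_contra h
      exact hne (T.actFun_of_notMem _ h).symm
    rw [T.actFun_of_mem _ hxst] at hne
    have hw := T.mem_suppIdeal.1 hf (Ne.symm hne)
    have hw' := T.mem_suppIdeal.1 hf' (Ne.symm hne)
    have hm := T.θ_mem_inv hw hw'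
    have hc := T.comp s t _ ⟨hw, by rwa [← mul_inv_rev_eq]⟩
    rw [T.θ_θ_inv hxst] at hc
    have h1 := T.θ_mem hm
    rw [hc] at h1
    refine hx ⟨h1, ?_⟩
    rw [← hc, T.θ_inv_θ hm]
    exact T.θ_mem hw

theorem actFun_inv_actFun {s : S} {f : LocConstCompact X R} (hf : f ∈ T.suppIdeal R s⁻¹) (x : X) :
    T.actFun s⁻¹ (T.actFun s f.1) x = f.1 x := by
  by_cases hx : x ∈ T.dom s⁻¹
  · rw [T.actFun_of_mem _ hx, inv_inv_eq, T.actFun_of_mem _ (T.θ_mem hx), T.θ_inv_θ hx]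
  · rw [T.actFun_of_notMem _ hx, T.apply_eq_zero hf hx]

theorem actFun_actFun_inv {s : S} {f : LocConstCompact X R} (hf : f ∈ T.suppIdeal R s) (x : X) :
    T.actFun s (T.actFun s⁻¹ f.1) x = f.1 x := by
  by_cases hx : x ∈ T.dom s
  · rw [T.actFun_of_mem _ hx, T.actFun_of_mem _ (T.θ_inv_mem hx), inv_inv_eq, T.θ_θ_inv hx]
  · rw [T.actFun_of_notMem _ hx, T.apply_eq_zero hf hx]

theorem ext_val {I : TwoSidedIdeal (LocConstCompact X R)} {f g : I}
    (h : ∀ x, f.1.1 x = g.1.1 x) : f = g :=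
  Subtype.ext (Subtype.ext (LocallyConstant.ext h))

/-- The product of `f` with the characteristic function of a clopen set. -/
def cut (f : LocConstCompact X R) {V : Set X} (hV : IsClopen V) : LocConstCompact X R :=
  ⟨f.1 * LocallyConstant.charFn R hV, f.2.of_isClosed_subset
    ((f.1 * LocallyConstant.charFn R hV).isLocallyConstant.isClopen_fiber 0).compl.isClosed
    (Function.support_mul_subset_left _ _)⟩

theorem cut_apply_of_mem (f : LocConstCompact X R) {V : Set X} (hV : IsClopen V) {x : X}
    (hx : x ∈ V) : (cut f hV).1 x = f.1 x := by
  change f.1 x * LocallyConstant.charFn R hV x = _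
  rw [LocallyConstant.coe_charFn, Set.indicator_of_mem hx, Pi.one_apply, mul_one]

theorem cut_apply_of_notMem (f : LocConstCompact X R) {V : Set X} (hV : IsClopen V) {x : X}
    (hx : x ∉ V) : (cut f hV).1 x = 0 := by
  change f.1 x * LocallyConstant.charFn R hV x = _
  rw [LocallyConstant.coe_charFn, Set.indicator_of_notMem hx, mul_zero]

variable [T2Space X]

theorem isLocallyConstant_actFun {s : S} {f : LocConstCompact X R}
    (hf : f ∈ T.suppIdeal R s⁻¹) : IsLocallyConstant (T.actFun s f.1) := by
  rw [IsLocallyConstant.iff_eventually_eq]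
  intro x
  by_cases hx : x ∈ T.dom s
  · have hn := (T.isOpen_dom s).mem_nhds hx
    have hc := (T.continuousOn_θ_inv s).continuousAt hn
    filter_upwards [hn, hc.eventually (f.1.isLocallyConstant.eventually_eq _)] with y hy hy'
    rw [T.actFun_of_mem _ hx, T.actFun_of_mem _ hy]
    exact hy'
  · have h0 := T.actFun_of_notMem (s := s) f.1 hx
    have hn : (Function.support (T.actFun s f.1))ᶜ ∈ nhds x :=
      (T.isCompact_support_actFun hf).isClosed.isOpen_compl.mem_nhds (by simpa using h0)
    filter_upwards [hn] with y hy
    rw [h0]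
    simpa using hy

/-- The map `α_s : D_{s⁻¹} → D_s`. -/
def act (s : S) (f : T.suppIdeal R s⁻¹) : T.suppIdeal R s :=
  ⟨⟨⟨T.actFun s f.1.1, T.isLocallyConstant_actFun f.2⟩, T.isCompact_support_actFun f.2⟩,
    T.mem_suppIdeal.2 fun x hx => by
      by_contra h
      exact hx (T.actFun_of_notMem _ h)⟩

theorem act_apply (s : S) (f : T.suppIdeal R s⁻¹) (x : X) :
    (T.act s f).1.1 x = T.actFun s f.1.1 x := rfl

/-- The ring isomorphism `α_s : D_{s⁻¹} → D_s`. -/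
def actEquiv (s : S) : T.suppIdeal R s⁻¹ ≃+* T.suppIdeal R s where
  toFun := T.act s
  invFun f := T.act s⁻¹ ⟨f.1, by rw [inv_inv_eq]; exact f.2⟩
  left_inv f := ext_val fun x => T.actFun_inv_actFun f.2 x
  right_inv f := ext_val fun x => T.actFun_actFun_inv f.2 x
  map_mul' f g := by
    refine ext_val fun x => ?_
    change T.actFun s (fun y => f.1.1 y * g.1.1 y) x = T.actFun s f.1.1 x * T.actFun s g.1.1 x
    by_cases hx : x ∈ T.dom s
    · simp only [T.actFun_of_mem _ hx]
    · simp only [T.actFun_of_notMem _ hx, mul_zero]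
  map_add' f g := by
    refine ext_val fun x => ?_
    change T.actFun s (fun y => f.1.1 y + g.1.1 y) x = T.actFun s f.1.1 x + T.actFun s g.1.1 x
    by_cases hx : x ∈ T.dom s
    · simp only [T.actFun_of_mem _ hx]
    · simp only [T.actFun_of_notMem _ hx, add_zero]

theorem actEquiv_apply (s : S) (f : T.suppIdeal R s⁻¹) (x : X) :
    (T.actEquiv s f).1.1 x = T.actFun s f.1.1 x := rfl

theorem generates_aux [PrespectralSpace X] (f : LocConstCompact X R) :
    f ∈ AddSubgroup.closure
      {f : LocConstCompact X R | ∃ e : S, IsIdempotentElem e ∧ f ∈ T.suppIdeal R e} := by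
  have hloc : ∀ x : X, ∃ V : Set X, x ∈ V ∧ IsOpen V ∧ IsCompact V ∧
      ∃ e : S, IsIdempotentElem e ∧ V ⊆ T.dom e := by
    intro x
    obtain ⟨e, he, hx⟩ := T.cover x
    obtain ⟨V, ⟨hV, hV'⟩, hxV, hVe⟩ :=
      PrespectralSpace.isTopologicalBasis.exists_subset_of_mem_open hx (T.isOpen_dom e)
    exact ⟨V, hxV, hV, hV', e, he, hVe⟩
  choose V hxV hVo hVc e he hVe using hloc
  have hclopen : ∀ x, IsClopen (V x) := fun x => ⟨(hVc x).isClosed, hVo x⟩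
  have key : ∀ (t : Finset X) (g : LocConstCompact X R),
      Function.support g.1 ⊆ ⋃ x ∈ t, V x → g ∈ AddSubgroup.closure
      {f : LocConstCompact X R | ∃ e : S, IsIdempotentElem e ∧ f ∈ T.suppIdeal R e} := by
    intro t
    classical
    induction t using Finset.induction_on with
    | empty =>
      intro g hg
      have : g = 0 := by
        refine Subtype.ext (LocallyConstant.ext fun x => ?_)
        by_contra h
        simpa using hg h
      rw [this]
      exact zero_mem _
    | insert a t _ ih =>
      intro g hg
      have hdec : g = cut g (hclopen a) + cut g (hclopen a).compl := by
        refine Subtype.ext (LocallyConstant.ext fun x => ?_)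
        change g.1 x = (cut g (hclopen a)).1 x + (cut g (hclopen a).compl).1 x
        by_cases hx : x ∈ V a
        · rw [cut_apply_of_mem _ _ hx, cut_apply_of_notMem _ _ (by simpa using hx), add_zero]
        · rw [cut_apply_of_notMem _ _ hx, cut_apply_of_mem _ _ (by simpa using hx), zero_add]
      rw [hdec]
      refine add_mem (AddSubgroup.subset_closure ⟨e a, he a, T.mem_suppIdeal.2 fun x hx => ?_⟩)
        (ih _ fun x hx => ?_)
      · by_contra h
        exact hx (cut_apply_of_notMem _ _ fun h' => h (hVe a h'))
      · have h1 : x ∉ V a := fun h' => hx (cut_apply_of_notMem _ _ (by simpa using h'))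
        have h2 : x ∈ Function.support g.1 := by
          rw [Function.mem_support, ← cut_apply_of_mem g (hclopen a).compl h1]
          exact hx
        have h3 := hg h2
        rw [Finset.set_biUnion_insert] at h3
        exact h3.resolve_left h1
  obtain ⟨t, -, ht⟩ := f.2.elim_nhds_subcover V fun x _ => (hVo x).mem_nhds (hxV x)
  exact key t f ht

variable (R)

/-- The partial action `α` of `S` on `𝓛_c(X)` associated with a topological partial action of `S`
on a zero-dimensional locally compact Hausdorff space `X`. -/
def toRing [PrespectralSpace X] : RingPartialAction S (LocConstCompact X R) where
  D := T.suppIdeal R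
  π := T.actEquiv
  generates := by
    rw [eq_top_iff]
    exact fun f _ => T.generates_aux f
  image_inter s t := by
    ext f
    constructor
    · rintro ⟨g, hg, rfl⟩
      refine ⟨(T.actEquiv s g).2, T.mem_suppIdeal.2 ?_⟩
      change Function.support (T.actFun s g.1.1) ⊆ _
      rw [T.support_actFun g.2]
      have h : T.θ s '' (T.dom s⁻¹ ∩ T.dom t) ⊆ T.dom (s * t) := by
        rw [T.image_inter]; exact Set.inter_subset_right
      exact (Set.image_mono
        (Set.subset_inter (T.mem_suppIdeal.1 g.2) (T.mem_suppIdeal.1 hg))).trans h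
    · rintro ⟨h1, h2⟩
      refine ⟨(T.actEquiv s).symm ⟨f, h1⟩, T.mem_suppIdeal.2 fun x hx => ?_, by simp⟩
      have hx1 : x ∈ T.dom s⁻¹ := T.mem_suppIdeal.1 ((T.actEquiv s).symm ⟨f, h1⟩).2 hx
      change T.actFun s⁻¹ f.1 x ≠ 0 at hx
      rw [T.actFun_of_mem _ hx1, inv_inv_eq] at hx
      have h3 : T.θ s x ∈ T.θ s '' (T.dom s⁻¹ ∩ T.dom t) := by
        rw [T.image_inter]
        exact ⟨T.mem_suppIdeal.1 h1 hx, T.mem_suppIdeal.1 h2 hx⟩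
      obtain ⟨y, hy, hxy⟩ := h3
      have : y = x := (T.θ s).injOn (by rw [T.source_eq]; exact hy.1)
        (by rw [T.source_eq]; exact hx1) hxy
      exact this ▸ hy.2
  comp s t f hf hf' := by
    refine ⟨T.mem_suppIdeal.2 ?_, ?_⟩
    · change Function.support (T.actFun t f.1) ⊆ _
      rw [T.support_actFun hf]
      rintro _ ⟨x, hx, rfl⟩
      exact T.θ_mem_inv (T.mem_suppIdeal.1 hf hx) (T.mem_suppIdeal.1 hf' hx)
    · refine Subtype.ext (LocallyConstant.ext fun x => ?_)
      exact T.actFun_comp hf hf' x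

end

end TopologicalPartialAction

/-! The skew ring acts by row-finite matrices over `R` indexed by `X`: the row at `x` of `f δ_s` is
`f x` times the point mass at `θ_{s⁻¹} x` (`orbitRow`). This kills the relators and is
multiplicative, and the sum of the row at `x` is the value of `τ̃` at `x` (`tauTilde_apply`). Hence
`τ̃` vanishes on the kernel `orbitKernel` of the representation.

For (1), the support of `τ̃ w` is open, so it contains some `x` in the dense set `Λ(θ)`. The row of
`w` at `x` has a non-zero entry, at some `θ_{t⁻¹} x`. Multiplying on the right by a bump `u δ_{t⁻¹}`
moves that entry to position `(x, x)`, and multiplying on the left by a bump `v δ_e` localizes at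
`x`. If both bumps have small enough support, every term of `w` either dies or, by trivial isotropy
at `x`, becomes a term over an idempotent (`exists_nhds_mul_mem_diagonal`). The outcome is a
diagonal element of the ideal with a non-zero matrix entry.

For (2), `orbitKernel` must be zero. An element `w` commuting with the diagonal has a diagonal
matrix, because bump functions separate points, and its entries are the values of `τ̃ w`
(`orbitRow_eq_single_of_commute`). Some `d` in the diagonal subring has `τ̃ d = τ̃ w`, hence the
same matrix; so `w = d`. -/

namespace RingPartialAction

/-! ### Maps out of the skew ring, and its diagonal -/

variable {S A : Type*} [InverseSemigroup S] [NonUnitalRing A] (P : RingPartialAction S A)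

theorem toSkew_surjective : Function.Surjective P.toSkew := Quotient.mk_surjective

theorem toSkew_mul (x y : P.PreSkewRing) : P.toSkew (x * y) = P.toSkew x * P.toSkew y := rfl

/-- The additive map out of `A ⋊ S` induced by an additive map that kills the relators. -/
noncomputable def skewLift {M : Type*} [AddCommGroup M] (φ : P.PreSkewRing →+ M)
    (h : ∀ x ∈ P.relators, φ x = 0) : P.SkewRing →+ M where
  toFun := Quotient.lift (fun x => φ x) fun x y hxy => by
    -- The relators generate the ideal already as an additive group, so an additive map needs no
    -- compatibility with products to descend.
    have hle : AddSubgroup.closure P.relators ≤ φ.ker := (AddSubgroup.closure_le _).2 h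
    have := hle (P.mem_closure_of_mem_relIdeal ((P.relIdeal.rel_iff x y).1 hxy))
    rwa [AddMonoidHom.mem_ker, map_sub, sub_eq_zero] at this
  map_zero' := map_zero φ
  map_add' x y := by
    induction x using Quotient.inductionOn
    induction y using Quotient.inductionOn
    exact map_add φ _ _

theorem skewRing_induction {p : P.SkewRing → Prop} (x : P.SkewRing) (zero : p 0)
    (single : ∀ s a, p (P.toSkew (P.single s a))) (add : ∀ x y, p x → p y → p (x + y)) : p x := by
  obtain ⟨x, rfl⟩ := P.toSkew_surjective x
  induction x using P.preSkewRing_induction with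
  | zero => exact zero
  | single s a => exact single s a
  | add x y hx hy => exact add _ _ hx hy

/-- One relator, read from the larger index to the smaller: a term whose coefficient lives in a
smaller ideal may be re-indexed. This is how terms over arbitrary `s` become terms over idempotents.
-/
theorem toSkew_single_of_natLE {r s : S} (h : NatLE r s) (a : P.D s) (ha : (a : A) ∈ P.D r) :
    P.toSkew (P.single s a) = P.toSkew (P.single r ⟨a, ha⟩) := by
  symm
  refine Quotient.sound ((P.relIdeal.rel_iff _ _).2 (TwoSidedIdeal.subset_span ?_))
  exact ⟨r, s, h, ⟨a, ha⟩, rfl⟩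

theorem toSkew_single_idem_mem_diagonal {e : S} (he : IsIdempotentElem e) (a : P.D e) :
    P.toSkew (P.single e a) ∈ P.diagonal :=
  ⟨1, fun _ => e, fun _ => a, fun _ => he, by simp⟩

theorem diagonal_induction {p : P.SkewRing → Prop} {x : P.SkewRing} (hx : x ∈ P.diagonal)
    (zero : p 0) (single : ∀ e, IsIdempotentElem e → ∀ a, p (P.toSkew (P.single e a)))
    (add : ∀ x y, p x → p y → p (x + y)) : p x := by
  obtain ⟨n, e, a, he, rfl⟩ := hx
  exact Finset.sum_induction _ p add zero fun i _ => single _ (he i) _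

/-- The axiom that the ideals `D e` generate `A` additively says exactly that `τ̃` is already onto
when restricted to the diagonal. -/
theorem exists_mem_diagonal_tauTilde_eq (a : A) : ∃ d ∈ P.diagonal, P.tauTilde d = a := by
  have ha : a ∈ AddSubgroup.closure {a : A | ∃ e : S, IsIdempotentElem e ∧ a ∈ P.D e} := by
    rw [P.generates]; trivial
  induction ha using AddSubgroup.closure_induction with
  | mem a h =>
    obtain ⟨e, he, ha⟩ := h
    exact ⟨_, P.toSkew_single_idem_mem_diagonal he ⟨a, ha⟩, P.tau_single e ⟨a, ha⟩⟩
  | zero => exact ⟨0, zero_mem _, map_zero _⟩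
  | add a b _ _ ha hb =>
    obtain ⟨d, hd, rfl⟩ := ha
    obtain ⟨d', hd', rfl⟩ := hb
    exact ⟨d + d', add_mem hd hd', map_add _ _ _⟩
  | neg a _ ha =>
    obtain ⟨d, hd, rfl⟩ := ha
    exact ⟨-d, neg_mem hd, map_neg _ _⟩

end RingPartialAction

/-! ### Points and the natural order under a topological partial action -/

namespace TopologicalPartialAction

variable {S X R : Type*} [InverseSemigroup S] [TopologicalSpace X] [CommRing R]
  (T : TopologicalPartialAction S X)

theorem mem_dom_mul_of_idem {e t : S} (he : IsIdempotentElem e) {x : X} (hx : x ∈ T.dom e)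
    (hx' : x ∈ T.dom t) : x ∈ T.dom (e * t) := by
  have h : T.θ e x ∈ T.θ e '' (T.dom e⁻¹ ∩ T.dom t) :=
    ⟨x, ⟨by rwa [inv_eq_self he], hx'⟩, rfl⟩
  rw [T.image_inter, T.θ_idem he hx] at h
  exact h.2

theorem θ_inv_mul {s t : S} {x : X} (hx : x ∈ T.dom s) (hx' : T.θ s⁻¹ x ∈ T.dom t) :
    T.θ (s * t)⁻¹ x = T.θ t⁻¹ (T.θ s⁻¹ x) := by
  have h : T.θ s (T.θ s⁻¹ x) ∈ T.θ s '' (T.dom s⁻¹ ∩ T.dom t) :=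
    ⟨_, ⟨T.θ_inv_mem hx, hx'⟩, rfl⟩
  rw [T.image_inter, T.θ_θ_inv hx] at h
  rw [mul_inv_rev_eq, T.comp t⁻¹ s⁻¹ x]
  rwa [inv_inv_eq, inv_inv_eq]

/-- On `X_r` the map of the smaller element is a restriction of that of the larger one: `r⁻¹ = s⁻¹
(r r⁻¹)`, and the idempotent `r r⁻¹` acts as the identity. This makes matrix rows insensitive to the
relators. -/
theorem θ_inv_of_natLE {r s : S} (h : NatLE r s) {x : X} (hx : x ∈ T.dom r) :
    T.θ r⁻¹ x = T.θ s⁻¹ x := by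
  obtain ⟨f, hf, hr⟩ := h.exists_idem_mul
  have hf' : r * r⁻¹ * s = r := by
    have hc := idem_comm (isIdempotentElem_mul_inv s) hf
    calc r * r⁻¹ * s = f * (s * s⁻¹ * f) * s := by
          rw [hr, mul_inv_rev_eq, inv_eq_self hf]; simp only [mul_assoc]
      _ = f * f * (s * s⁻¹ * s) := by rw [hc]; simp only [mul_assoc]
      _ = r := by rw [hf.eq, mul_inv_mul_self, hr]
  have he := isIdempotentElem_mul_inv r
  have hx1 := T.mem_mul_inv hx
  have hcomp := T.comp s⁻¹ (r * r⁻¹) x (by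
    rw [inv_inv_eq, inv_eq_self he, hf']; exact ⟨hx1, hx⟩)
  rw [T.θ_idem he hx1] at hcomp
  rw [hcomp]
  congr 2
  calc r⁻¹ = (r * r⁻¹ * s)⁻¹ := by rw [hf']
    _ = s⁻¹ * (r * r⁻¹) := by rw [mul_inv_rev_eq, inv_eq_self he]

/-- If `s⁻¹` and `t⁻¹` send `x` to the same point, then `s t⁻¹` fixes `x`, so the definition of
`Λ(θ)` applies to `s t⁻¹`. -/
theorem exists_idem_natLE_of_mem_trivialIsotropy {x : X} (hx : x ∈ T.trivialIsotropy) {s t : S}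
    (hs : x ∈ T.dom s) (ht : x ∈ T.dom t) (h : T.θ s⁻¹ x = T.θ t⁻¹ x) :
    ∃ e : S, IsIdempotentElem e ∧ NatLE e (s * t⁻¹) ∧ x ∈ T.dom e := by
  have hsx := T.θ_inv_mem hs
  have htx := T.θ_inv_mem ht
  have h1 : T.θ t (T.θ t⁻¹ x) ∈ T.θ t '' (T.dom t⁻¹ ∩ T.dom s⁻¹) :=
    ⟨_, ⟨htx, h ▸ hsx⟩, rfl⟩
  rw [T.image_inter, T.θ_θ_inv ht] at h1
  refine hx _ (by rw [mul_inv_rev_eq, inv_inv_eq]; exact h1.2) ?_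
  rw [← T.comp s t⁻¹ x (by rwa [inv_inv_eq]), ← h, T.θ_θ_inv hs]

/-! ### The matrix representation on points of `X` -/

variable [T2Space X] [PrespectralSpace X]

/-- The formula holds at every `x`: off `X_s` the factor `a` vanishes, so the junk value of `θ s⁻¹`
there is harmless. -/
theorem coe_prod_apply (s t : S) (a : (T.toRing R).D s) (b : (T.toRing R).D t) (x : X) :
    ((T.toRing R).prod s t a b).1.1 x = a.1.1 x * b.1.1 (T.θ s⁻¹ x) := by
  change T.actFun s (fun y => T.actFun s⁻¹ a.1.1 y * b.1.1 y) x = _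
  by_cases hx : x ∈ T.dom s
  · rw [T.actFun_of_mem _ hx, T.actFun_of_mem _ (T.θ_inv_mem hx), inv_inv_eq, T.θ_θ_inv hx]
  · rw [T.actFun_of_notMem _ hx, T.apply_eq_zero a.2 hx, zero_mul]

variable (R)

/-- Evaluation of functions at a point. -/
def evalHom (x : X) : LocConstCompact X R →+ R where
  toFun f := f.1 x
  map_zero' := rfl
  map_add' _ _ := rfl

noncomputable section

/-- The row at `x` of the representation of `𝓛_c(X) ⋊ S` on finitely supported functions on `X`:
it sends `f δ_s` to `f x` times the point mass at `θ_{s⁻¹} x`. -/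
def preOrbitRow (x : X) : (T.toRing R).PreSkewRing →+ (X →₀ R) :=
  (T.toRing R).lift fun s => (Finsupp.singleAddHom (T.θ s⁻¹ x)).comp
    ((evalHom R x).comp ((T.toRing R).D s).coeAddMonoidHom)

theorem preOrbitRow_single (x : X) (s : S) (a : (T.toRing R).D s) :
    T.preOrbitRow R x ((T.toRing R).single s a) = Finsupp.single (T.θ s⁻¹ x) (a.1.1 x) :=
  (T.toRing R).lift_single _ s a

/-- The additive map induced by `preOrbitRow` on `𝓛_c(X) ⋊ S`. -/
def orbitRow (x : X) : (T.toRing R).SkewRing →+ (X →₀ R) :=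
  (T.toRing R).skewLift (T.preOrbitRow R x) <| by
    rintro _ ⟨r, s, h, a, rfl⟩
    rw [map_sub, preOrbitRow_single, preOrbitRow_single, sub_eq_zero]
    by_cases hx : x ∈ T.dom r
    · rw [T.θ_inv_of_natLE h hx]
    · rw [T.apply_eq_zero a.2 hx, Finsupp.single_zero, Finsupp.single_zero]

variable {R}

theorem orbitRow_single (x : X) (s : S) (a : (T.toRing R).D s) :
    T.orbitRow R x ((T.toRing R).toSkew ((T.toRing R).single s a)) =
      Finsupp.single (T.θ s⁻¹ x) (a.1.1 x) :=
  T.preOrbitRow_single R x s a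

/-- Matrix multiplication on the left: the row of `a δ_s` at `x` has a single entry, which selects
the row of `w` at `θ_{s⁻¹} x`. -/
theorem orbitRow_single_mul (x : X) (s : S) (a : (T.toRing R).D s) (w : (T.toRing R).SkewRing) :
    T.orbitRow R x ((T.toRing R).toSkew ((T.toRing R).single s a) * w) =
      a.1.1 x • T.orbitRow R (T.θ s⁻¹ x) w := by
  induction w using (T.toRing R).skewRing_induction with
  | zero => rw [mul_zero, map_zero, map_zero, smul_zero]
  | add v w hv hw => rw [mul_add, map_add, map_add, hv, hw, smul_add]
  | single t b =>
    rw [← (T.toRing R).toSkew_mul, (T.toRing R).single_mul_single, orbitRow_single,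
      orbitRow_single, coe_prod_apply, Finsupp.smul_single, smul_eq_mul]
    by_cases hx : x ∈ T.dom s
    · by_cases hx' : T.θ s⁻¹ x ∈ T.dom t
      · rw [T.θ_inv_mul hx hx']
      · rw [T.apply_eq_zero b.2 hx', mul_zero, Finsupp.single_zero, Finsupp.single_zero]
    · rw [T.apply_eq_zero a.2 hx, zero_mul, Finsupp.single_zero, Finsupp.single_zero]

/-- Matrix multiplication on the right: since `θ t` is injective on its source, the column of `b
δ_t` at `y` has at most one non-zero entry, in row `θ t y`. For `y` outside the source that column
is zero, which is the companion lemma below. -/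
theorem orbitRow_mul_single_of_mem (x : X) {t : S} (b : (T.toRing R).D t)
    (w : (T.toRing R).SkewRing) {y : X} (hy : y ∈ T.dom t⁻¹) :
    T.orbitRow R x (w * (T.toRing R).toSkew ((T.toRing R).single t b)) y =
      T.orbitRow R x w (T.θ t y) * b.1.1 (T.θ t y) := by
  classical
  induction w using (T.toRing R).skewRing_induction with
  | zero => simp
  | add v w hv hw => rw [add_mul, map_add, map_add, Finsupp.add_apply, Finsupp.add_apply, hv, hw,
      add_mul]
  | single s a =>
    rw [orbitRow_single_mul, orbitRow_single, orbitRow_single, Finsupp.smul_apply,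
      Finsupp.single_apply, Finsupp.single_apply, smul_eq_mul]
    by_cases h : T.θ s⁻¹ x = T.θ t y
    · rw [if_pos h, h, T.θ_inv_θ hy, if_pos rfl]
    · rw [if_neg h, zero_mul]
      by_cases hx : T.θ s⁻¹ x ∈ T.dom t
      · rw [if_neg, mul_zero]
        rintro rfl
        exact h (T.θ_θ_inv hx).symm
      · rw [T.apply_eq_zero b.2 hx, ite_self, mul_zero]

theorem orbitRow_mul_single_of_notMem (x : X) {t : S} (b : (T.toRing R).D t)
    (w : (T.toRing R).SkewRing) {y : X} (hy : y ∉ T.dom t⁻¹) :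
    T.orbitRow R x (w * (T.toRing R).toSkew ((T.toRing R).single t b)) y = 0 := by
  classical
  induction w using (T.toRing R).skewRing_induction with
  | zero => simp
  | add v w hv hw => rw [add_mul, map_add, Finsupp.add_apply, hv, hw, add_zero]
  | single s a =>
    rw [orbitRow_single_mul, orbitRow_single, Finsupp.smul_apply, Finsupp.single_apply]
    by_cases hx : T.θ s⁻¹ x ∈ T.dom t
    · rw [if_neg, smul_zero]
      rintro rfl
      exact hy (T.θ_inv_mem hx)
    · rw [T.apply_eq_zero b.2 hx, ite_self, smul_zero]

/-- Since `e` acts as the identity on `X_e`, a term over `e` is a diagonal matrix. It scales rows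
from the left and, by `orbitRow_mul_idem`, columns from the right. -/
theorem orbitRow_idem_mul {e : S} (he : IsIdempotentElem e) (a : (T.toRing R).D e)
    (w : (T.toRing R).SkewRing) (x : X) :
    T.orbitRow R x ((T.toRing R).toSkew ((T.toRing R).single e a) * w) =
      a.1.1 x • T.orbitRow R x w := by
  rw [orbitRow_single_mul, inv_eq_self he]
  by_cases hx : x ∈ T.dom e
  · rw [T.θ_idem he hx]
  · rw [T.apply_eq_zero a.2 hx, zero_smul, zero_smul]

theorem orbitRow_mul_idem {e : S} (he : IsIdempotentElem e) (a : (T.toRing R).D e)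
    (w : (T.toRing R).SkewRing) (x y : X) :
    T.orbitRow R x (w * (T.toRing R).toSkew ((T.toRing R).single e a)) y =
      T.orbitRow R x w y * a.1.1 y := by
  by_cases hy : y ∈ T.dom e
  · rw [orbitRow_mul_single_of_mem _ _ _ _ (by rwa [inv_eq_self he]), T.θ_idem he hy]
  · rw [orbitRow_mul_single_of_notMem _ _ _ _ (by rwa [inv_eq_self he]),
      T.apply_eq_zero a.2 hy, mul_zero]

/-- Row sums recover `τ̃`: the representation remembers where each coefficient is sent, and `τ̃`
forgets it. -/
theorem tauTilde_apply (w : (T.toRing R).SkewRing) (x : X) :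
    ((T.toRing R).tauTilde w).1 x = (T.orbitRow R x w).sum fun _ r => r := by
  induction w using (T.toRing R).skewRing_induction with
  | zero => rw [map_zero, map_zero, Finsupp.sum_zero_index]; rfl
  | add v w hv hw =>
    rw [map_add, map_add, Finsupp.sum_add_index' (fun _ => rfl) fun _ _ _ => rfl, ← hv, ← hw]
    rfl
  | single s a =>
    rw [orbitRow_single, Finsupp.sum_single_index rfl, (T.toRing R).tauTilde_toSkew,
      (T.toRing R).tau_single]

theorem exists_θ_inv_eq_of_orbitRow_ne_zero {w : (T.toRing R).SkewRing} {x y : X}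
    (h : T.orbitRow R x w y ≠ 0) : ∃ s : S, x ∈ T.dom s ∧ T.θ s⁻¹ x = y := by
  classical
  induction w using (T.toRing R).skewRing_induction with
  | zero => simp at h
  | add v w hv hw =>
    by_cases h0 : T.orbitRow R x v y = 0
    · rw [map_add, Finsupp.add_apply, h0, zero_add] at h
      exact hw h
    · exact hv h0
  | single s a =>
    rw [orbitRow_single, Finsupp.single_apply] at h
    refine ⟨s, ?_, ?_⟩
    · by_contra hx
      exact h (by rw [T.apply_eq_zero a.2 hx, ite_self])
    · by_contra hx
      exact h (if_neg hx)

variable (R) in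
/-- The kernel of the representation of `𝓛_c(X) ⋊ S` on finitely supported functions on `X`. -/
def orbitKernel : TwoSidedIdeal (T.toRing R).SkewRing :=
  TwoSidedIdeal.mk' {w | ∀ x, T.orbitRow R x w = 0}
    (fun x => map_zero _)
    (fun {v w} hv hw x => by rw [map_add, hv, hw, add_zero])
    (fun {v} hv x => by rw [map_neg, hv, neg_zero])
    (fun {v w} hw x => by
      induction v using (T.toRing R).skewRing_induction with
      | zero => rw [zero_mul, map_zero]
      | add u v hu hv => rw [add_mul, map_add, hu, hv, add_zero]
      | single s a => rw [orbitRow_single_mul, hw, smul_zero])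
    (fun {v w} hv x => by
      induction w using (T.toRing R).skewRing_induction with
      | zero => rw [mul_zero, map_zero]
      | add u w hu hw => rw [mul_add, map_add, hu, hw, add_zero]
      | single s a =>
        ext y
        by_cases hy : y ∈ T.dom s⁻¹
        · rw [orbitRow_mul_single_of_mem _ _ _ _ hy, hv, Finsupp.zero_apply, zero_mul,
            Finsupp.zero_apply]
        · rw [orbitRow_mul_single_of_notMem _ _ _ _ hy, Finsupp.zero_apply])

theorem mem_orbitKernel {w : (T.toRing R).SkewRing} :
    w ∈ T.orbitKernel R ↔ ∀ x, T.orbitRow R x w = 0 :=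
  TwoSidedIdeal.mem_mk' _ _ _ _ _ _ _

theorem tauTilde_eq_zero_of_mem_orbitKernel {w : (T.toRing R).SkewRing}
    (hw : w ∈ T.orbitKernel R) (x : X) : ((T.toRing R).tauTilde w).1 x = 0 := by
  rw [tauTilde_apply, T.mem_orbitKernel.1 hw, Finsupp.sum_zero_index]

/-! ### Bump functions -/

variable (R) in
/-- The characteristic function of a compact open subset of `X_s`, as an element of `D_s`. -/
def indicator {s : S} {V : Set X} (hV : IsClopen V) (hVc : IsCompact V) (hVs : V ⊆ T.dom s) :
    (T.toRing R).D s :=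
  have hsupp : Function.support (LocallyConstant.charFn R hV) ⊆ V := by
    rw [LocallyConstant.coe_charFn]; exact Set.support_indicator_subset
  ⟨⟨LocallyConstant.charFn R hV, hVc.of_isClosed_subset
    ((LocallyConstant.charFn R hV).isLocallyConstant.isClopen_fiber 0).compl.isClosed hsupp⟩,
    T.mem_suppIdeal.2 (hsupp.trans hVs)⟩

theorem indicator_apply {s : S} {V : Set X} (hV : IsClopen V) (hVc : IsCompact V)
    (hVs : V ⊆ T.dom s) (x : X) : (T.indicator R hV hVc hVs).1.1 x = V.indicator 1 x := by
  change LocallyConstant.charFn R hV x = _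
  rw [LocallyConstant.coe_charFn]

variable (R) in
theorem exists_bump {s : S} {x : X} (hx : x ∈ T.dom s) {U : Set X} (hU : IsOpen U) (hxU : x ∈ U) :
    ∃ a : (T.toRing R).D s, a.1.1 x = 1 ∧ ∀ y ∉ U, a.1.1 y = 0 := by
  obtain ⟨V, ⟨hVo, hV⟩, hxV, hVU⟩ := PrespectralSpace.isTopologicalBasis.exists_subset_of_mem_open
    (show x ∈ T.dom s ∩ U from ⟨hx, hxU⟩) ((T.isOpen_dom s).inter hU)
  have hVc : IsClopen V := ⟨hV.isClosed, hVo⟩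
  refine ⟨T.indicator R hVc hV (hVU.trans Set.inter_subset_left), ?_,
    fun y hy => ?_⟩
  · rw [indicator_apply, Set.indicator_of_mem hxV, Pi.one_apply]
  · rw [indicator_apply, Set.indicator_of_notMem fun h => hy (hVU h).2]

/-! ### Elements commuting with the diagonal -/

/-- Over idempotents the twist by `θ` disappears, so both products have the pointwise product as
coefficient, and `e f = f e`. -/
theorem diagonal_comm {v w : (T.toRing R).SkewRing} (hv : v ∈ (T.toRing R).diagonal)
    (hw : w ∈ (T.toRing R).diagonal) : v * w = w * v := by
  refine (T.toRing R).diagonal_induction (p := fun v => v * w = w * v) hv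
    (by rw [zero_mul, mul_zero]) (fun e he a => ?_)
    fun x y hx hy => by rw [add_mul, mul_add, hx, hy]
  refine (T.toRing R).diagonal_induction
    (p := fun w => (T.toRing R).toSkew ((T.toRing R).single e a) * w =
      w * (T.toRing R).toSkew ((T.toRing R).single e a)) hw
    (by rw [zero_mul, mul_zero]) (fun f hf b => ?_)
    fun x y hx hy => by rw [mul_add, add_mul, hx, hy]
  rw [← (T.toRing R).toSkew_mul, ← (T.toRing R).toSkew_mul, (T.toRing R).single_mul_single,
    (T.toRing R).single_mul_single]
  refine congrArg _ ((T.toRing R).single_congr (idem_comm he hf)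
    (Subtype.ext (LocallyConstant.ext fun x => ?_)))
  rw [coe_prod_apply, coe_prod_apply, inv_eq_self he, inv_eq_self hf]
  by_cases hx : x ∈ T.dom e
  · by_cases hx' : x ∈ T.dom f
    · rw [T.θ_idem he hx, T.θ_idem hf hx', mul_comm]
    · rw [T.θ_idem he hx, T.apply_eq_zero b.2 hx', mul_zero, zero_mul]
  · by_cases hx' : x ∈ T.dom f
    · rw [T.θ_idem hf hx', T.apply_eq_zero a.2 hx, mul_zero, zero_mul]
    · rw [T.apply_eq_zero a.2 hx, T.apply_eq_zero b.2 hx', zero_mul, zero_mul]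

theorem orbitRow_eq_single_of_commute {w : (T.toRing R).SkewRing}
    (hw : ∀ d ∈ (T.toRing R).diagonal, d * w = w * d) (x : X) :
    T.orbitRow R x w = Finsupp.single x (((T.toRing R).tauTilde w).1 x) := by
  have h0 : ∀ y, y ≠ x → T.orbitRow R x w y = 0 := by
    -- Take a bump `a` equal to `1` at `x` and `0` at `y`. Comparing the `(x, y)` entries of `a δ_e
    -- w = w (a δ_e)` gives the entry of `w` on one side and `0` on the other.
    intro y hy
    obtain ⟨e, he, hx⟩ := T.cover x
    obtain ⟨a, ha, ha'⟩ := T.exists_bump R hx isOpen_compl_singleton hy.symm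
    have h := DFunLike.congr_fun (congrArg (T.orbitRow R x)
      (hw _ ((T.toRing R).toSkew_single_idem_mem_diagonal he a))) y
    rwa [T.orbitRow_idem_mul he, T.orbitRow_mul_idem he, ha, one_smul, ha' y (by simp),
      mul_zero] at h
  have h1 : T.orbitRow R x w = Finsupp.single x (T.orbitRow R x w x) := by
    classical
    ext y
    rw [Finsupp.single_apply]
    split_ifs with h
    · rw [h]
    · exact h0 y (Ne.symm h)
  rw [tauTilde_apply, h1, Finsupp.sum_single_index rfl]

/-! ### Cutting an element down to the diagonal near a point of `Λ(θ)` -/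

/-- The neighbourhoods are chosen before the bumps `v`, `u`, so for a sum one intersects those of
the summands, and a single term `a δ_s` remains. It is handled according to whether `x` lies in
`X_s` and, if so, whether `θ_{s⁻¹} x` agrees with `θ_{t⁻¹} x`. -/
theorem exists_nhds_mul_mem_diagonal {x : X} (hx : x ∈ T.trivialIsotropy) {t : S}
    (ht : x ∈ T.dom t) (w : (T.toRing R).SkewRing) :
    ∃ U U' : Set X, IsOpen U ∧ IsOpen U' ∧ x ∈ U ∧ T.θ t⁻¹ x ∈ U' ∧
      ∀ (e : S) (v : (T.toRing R).D e) (u : (T.toRing R).D t⁻¹), IsIdempotentElem e →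
        (∀ p ∉ U, v.1.1 p = 0) → (∀ p ∉ U', u.1.1 p = 0) →
        (T.toRing R).toSkew ((T.toRing R).single e v) *
          (w * (T.toRing R).toSkew ((T.toRing R).single t⁻¹ u)) ∈ (T.toRing R).diagonal := by
  induction w using (T.toRing R).skewRing_induction with
  | zero =>
    refine ⟨Set.univ, Set.univ, isOpen_univ, isOpen_univ, trivial, trivial, ?_⟩
    intro e v u _ _ _
    rw [zero_mul, mul_zero]
    exact zero_mem _
  | add w w' hw hw' =>
    obtain ⟨U, V, hU, hV, hxU, hxV, h⟩ := hw
    obtain ⟨U', V', hU', hV', hxU', hxV', h'⟩ := hw'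
    refine ⟨U ∩ U', V ∩ V', hU.inter hU', hV.inter hV', ⟨hxU, hxU'⟩, ⟨hxV, hxV'⟩, ?_⟩
    intro e v u he hv hu
    rw [add_mul, mul_add]
    exact add_mem
      (h e v u he (fun p hp => hv p fun hq => hp hq.1) fun p hp => hu p fun hq => hp hq.1)
      (h' e v u he (fun p hp => hv p fun hq => hp hq.2) fun p hp => hu p fun hq => hp hq.2)
  | single s a =>
    have key : ∀ (e : S) (v : (T.toRing R).D e) (u : (T.toRing R).D t⁻¹), IsIdempotentElem e →
        ∀ p, ((T.toRing R).prod _ _ v ((T.toRing R).prod _ _ a u)).1.1 p =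
          v.1.1 p * (a.1.1 p * u.1.1 (T.θ s⁻¹ p)) := by
      intro e v u he p
      rw [coe_prod_apply, coe_prod_apply, inv_eq_self he]
      by_cases hp : p ∈ T.dom e
      · rw [T.θ_idem he hp]
      · rw [T.apply_eq_zero v.2 hp, zero_mul, zero_mul]
    have vanish : ∀ (e : S) (v : (T.toRing R).D e) (u : (T.toRing R).D t⁻¹), IsIdempotentElem e →
        (∀ p, v.1.1 p * (a.1.1 p * u.1.1 (T.θ s⁻¹ p)) = 0) →
        (T.toRing R).toSkew ((T.toRing R).single e v) *
          ((T.toRing R).toSkew ((T.toRing R).single s a) *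
            (T.toRing R).toSkew ((T.toRing R).single t⁻¹ u)) ∈ (T.toRing R).diagonal := by
      intro e v u he h
      rw [← (T.toRing R).toSkew_mul, ← (T.toRing R).toSkew_mul, (T.toRing R).single_mul_single,
        (T.toRing R).single_mul_single,
        show (T.toRing R).prod _ _ v ((T.toRing R).prod _ _ a u) = 0 from
          ext_val fun p => (key e v u he p).trans (h p), map_zero]
      exact zero_mem _
    by_cases hs : x ∈ T.dom s
    · by_cases hst : T.θ s⁻¹ x = T.θ t⁻¹ x
      -- The product sits over `e (s t⁻¹)`, which lies above the idempotent `e f`. With `v`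
      -- supported in `X_f`, its coefficient is supported in `X_{e f}`, so it may be re-indexed
      -- there.
      · obtain ⟨f, hf, hle, hxf⟩ := T.exists_idem_natLE_of_mem_trivialIsotropy hx hs ht hst
        refine ⟨T.dom f, Set.univ, T.isOpen_dom f, isOpen_univ, hxf, trivial, ?_⟩
        intro e v u he hv _
        rw [← (T.toRing R).toSkew_mul, ← (T.toRing R).toSkew_mul,
          (T.toRing R).single_mul_single, (T.toRing R).single_mul_single,
          (T.toRing R).toSkew_single_of_natLE (hle.mul_left e)]
        · exact (T.toRing R).toSkew_single_idem_mem_diagonal (isIdempotentElem_mul he hf) _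
        · refine T.mem_suppIdeal.2 fun p hp => ?_
          rw [Function.mem_support, key e v u he] at hp
          have hp := left_ne_zero_of_mul hp
          refine T.mem_dom_mul_of_idem he ?_ ?_
          · by_contra h
            exact hp (T.apply_eq_zero v.2 h)
          · by_contra h
            exact hp (hv p h)
      -- Different targets: with `A` and `B` disjoint, wherever `v` is non-zero the map `θ s⁻¹`
      -- lands in `A`, where `u` vanishes.
      · obtain ⟨A, B, hA, hB, hxA, hxB, hAB⟩ := t2_separation hst
        refine ⟨T.dom s ∩ T.θ s⁻¹ ⁻¹' A, B,
          (T.continuousOn_θ_inv s).isOpen_inter_preimage (T.isOpen_dom s) hA, hB, ⟨hs, hxA⟩,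
          hxB, ?_⟩
        intro e v u he hv hu
        refine vanish e v u he fun p => ?_
        by_cases hp : p ∈ T.dom s ∩ T.θ s⁻¹ ⁻¹' A
        · rw [hu _ fun h => Set.disjoint_left.1 hAB hp.2 h, mul_zero, mul_zero]
        · rw [hv p hp, zero_mul]
    -- Here `a x = 0`, and by local constancy the zero set of `a` is an open neighbourhood of `x`.
    · refine ⟨{p | a.1.1 p = 0}, Set.univ, (a.1.1.isLocallyConstant.isClopen_fiber 0).isOpen,
        isOpen_univ, T.apply_eq_zero a.2 hs, trivial, ?_⟩
      intro e v u he hv _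
      refine vanish e v u he fun p => ?_
      by_cases hp : a.1.1 p = 0
      · rw [hp, zero_mul, mul_zero]
      · rw [hv p hp, zero_mul]

/-! ### The two conclusions -/

/-- For a topologically principal partial action, an ideal on which `τ̃` does not vanish meets the
diagonal. -/
theorem TopologicallyPrincipal.exists_ne_zero_mem_diagonal {T : TopologicalPartialAction S X}
    (hT : T.TopologicallyPrincipal) {I : TwoSidedIdeal (T.toRing R).SkewRing}
    {w : (T.toRing R).SkewRing} (hw : w ∈ I)
    (hne : (Function.support ((T.toRing R).tauTilde w).1).Nonempty) :
    ∃ z ∈ I, z ∈ (T.toRing R).diagonal ∧ z ≠ 0 := by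
  obtain ⟨x, hxw, hx⟩ := hT.inter_open_nonempty _
    (((T.toRing R).tauTilde w).1.isLocallyConstant.isClopen_fiber 0).compl.isOpen hne
  have hrow : ∃ y, T.orbitRow R x w y ≠ 0 := by
    by_contra! h
    apply hxw
    change ((T.toRing R).tauTilde w).1 x = 0
    rw [tauTilde_apply, show T.orbitRow R x w = 0 from Finsupp.ext h, Finsupp.sum_zero_index]
  obtain ⟨y, hy⟩ := hrow
  obtain ⟨t, ht, rfl⟩ := T.exists_θ_inv_eq_of_orbitRow_ne_zero hy
  obtain ⟨e, he, hxe⟩ := T.cover x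
  obtain ⟨U, U', hU, hU', hxU, hxU', h⟩ := T.exists_nhds_mul_mem_diagonal hx ht w
  obtain ⟨v, hv1, hv⟩ := T.exists_bump R hxe hU hxU
  obtain ⟨u, hu1, hu⟩ := T.exists_bump R (T.θ_inv_mem ht) hU' hxU'
  -- The product is non-zero because its `(x, x)` entry equals the entry of `w` at `(x, θ_{t⁻¹} x)`:
  -- both bumps take the value `1` at the relevant points.
  refine ⟨_, I.mul_mem_left _ _ (I.mul_mem_right _ _ hw), h e v u he hv hu, fun h0 => hy ?_⟩
  have h1 := DFunLike.congr_fun (congrArg (T.orbitRow R x) h0) x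
  rwa [T.orbitRow_idem_mul he, hv1, one_smul,
    T.orbitRow_mul_single_of_mem _ _ _ (by rwa [inv_inv_eq]), hu1, mul_one, map_zero,
    Finsupp.zero_apply] at h1

/-- If `τ̃` vanishes on no non-zero ideal, then the diagonal is maximal commutative. -/
theorem isMaximalCommutative_diagonal
    (h : ∀ I : TwoSidedIdeal (T.toRing R).SkewRing, I ≠ ⊥ →
      ∃ f ∈ I, (Function.support ((T.toRing R).tauTilde f).1).Nonempty) :
    IsMaximalCommutative ((T.toRing R).diagonal : Set (T.toRing R).SkewRing) := by
  have hker : T.orbitKernel R = ⊥ := by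
    by_contra hne
    obtain ⟨f, hf, x, hx⟩ := h _ hne
    exact hx (T.tauTilde_eq_zero_of_mem_orbitKernel hf x)
  refine Set.Subset.antisymm (fun w hw => ?_) fun w hw d hd => T.diagonal_comm hd hw
  obtain ⟨d, hd, hdw⟩ := (T.toRing R).exists_mem_diagonal_tauTilde_eq ((T.toRing R).tauTilde w)
  -- Both `w` and `d` commute with the diagonal, so both matrices are diagonal with entries given by
  -- the same function `τ̃ w = τ̃ d`.
  have hmem : w - d ∈ T.orbitKernel R := T.mem_orbitKernel.2 fun x => by
    rw [map_sub, T.orbitRow_eq_single_of_commute hw,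
      T.orbitRow_eq_single_of_commute fun c hc => T.diagonal_comm hc hd, hdw, sub_self]
  rw [hker, TwoSidedIdeal.mem_bot, sub_eq_zero] at hmem
  rw [hmem]
  exact hd

end

end TopologicalPartialAction

theorem proposition4p10 {S X R : Type*} [InverseSemigroup S] [TopologicalSpace X] [T2Space X]
    [LocallyCompactSpace X] [PrespectralSpace X] [CommRing R]
    (T : TopologicalPartialAction S X) (hT : T.TopologicallyPrincipal) :
    (∀ I : TwoSidedIdeal (T.toRing R).SkewRing, I ≠ ⊥ →
      (∃ f ∈ I, (Function.support ((T.toRing R).tauTilde f).1).Nonempty) →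
      (I : Set (T.toRing R).SkewRing) ∩ ((T.toRing R).diagonal : Set (T.toRing R).SkewRing)
        ≠ {0}) ∧
    ((∀ I : TwoSidedIdeal (T.toRing R).SkewRing, I ≠ ⊥ →
      ∃ f ∈ I, (Function.support ((T.toRing R).tauTilde f).1).Nonempty) →
      IsMaximalCommutative ((T.toRing R).diagonal : Set (T.toRing R).SkewRing)) := by

  refine ⟨fun I _ ⟨f, hf, hne⟩ h => ?_, T.isMaximalCommutative_diagonal⟩
  obtain ⟨z, hzI, hzD, hz⟩ := hT.exists_ne_zero_mem_diagonal hf hne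
  exact hz (h.subset ⟨hzI, hzD⟩)
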